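/- Inputs are simple undirected graphs $G$ on the vertex set $[n]$, given by adjacency lists in which the neighbors of each vertex appear in an arbitrary order; $n$ is known to the algorithm. For an integer $p\ge 2$ let $S_p(G)=\sum_{v}\binom{\deg(v)}{p}$ be the number of $p$-stars of $G$ (a center together with $p$ distinct neighbors of it). A randomized algorithm accesses $G$ adaptively through three kinds of queries: a neighbor query $(v,i)$ returns the $i$-th neighbor of $v$, or $\bot$ if $i>\deg(v)$; a degree query $v$ returns $\deg(v)$; a random-edge query returns an edge of $G$ drawn uniformly at random, independently of everything else (and $\bot$ if $G$ has no edge). It finally outputs a real number. Each query counts as one, and internal randomness is free. For $\lambda\ge1$, the algorithm approximates $S_p$ on $G$ to within the multiplicative factor $\lambda$ with success probability $2/3$ if, with probability at least $2/3$, its output $\widehat S$ satisfies $S_p(G)/\lambda\le\widehat S\le\lambda S_p(G)$. **Theorem.** Fix an integer $p\ge2$, an approximation factor $\lambda\ge1$ and a constant $C>0$. There are constants $K\ge1$, $c>0$ and $N$, depending only on $p$, $\lambda$ and $C$, such that for every $n\ge N$ and every real $s$ with $1\le s\le Cn^p$ the following holds. If, on every input graph $G$ on $n$ vertices with $s/K\le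 S_p(G)\le Ks$ (and for every order of the adjacency lists), a randomized algorithm approximates $S_p$ to within the multiplicative factor $\lambda$ with success probability $2/3$ and almost surely makes at most $q$ queries, then $$q\ \ge\ c\,n^{1-1/p}.$$ In other words, approximating $S_p$ to any constant multiplicative factor with probability at least $2/3$ requires $\Omega(n^{1-1/p})$ neighbor, degree and random-edge queries in total, at every scale $S_p=\Theta(s)$ with $s=O(n^p)$. -/

import Mathlib

open MeasureTheory
open scoped ENNReal

universe u

/-- An input of the problem: a simple undirected graph on the vertex set `Fin n`, stored through
adjacency lists. `adj v` lists the neighbors of `v`, each exactly once, in an arbitrary order. -/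
structure GraphInput (n : ℕ) where
  graph : SimpleGraph (Fin n)
  adj : Fin n → List (Fin n)
  nodup_adj : ∀ v, (adj v).Nodup
  mem_adj : ∀ v w, w ∈ adj v ↔ graph.Adj v w

namespace GraphInput

variable {n : ℕ}

open Classical in
/-- The answer to a degree query. -/
noncomputable def degree (I : GraphInput n) (v : Fin n) : ℕ := I.graph.degree v

/-- The answer to a neighbor query. Positions are counted from `0`; the answer is `none` when the
position is at least the degree. -/
def neighbor (I : GraphInput n) (v : Fin n) (i : ℕ) : Option (Fin n) := (I.adj v)[i]?

open Classical in
/-- The law of the answer to a random edge query: a uniformly random edge (and `none` if the graph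
has no edge at all). -/
noncomputable def edgeLaw (I : GraphInput n) : PMF (Option (Sym2 (Fin n))) :=
  if h : I.graph.edgeFinset.Nonempty then (PMF.uniformOfFinset I.graph.edgeFinset h).map some
  else PMF.pure none

open Classical in
/-- The `p`-stars of the graph, each given by its center and its set of `p` leaves, all of them
adjacent to the center. (For `p ≥ 2` a star subgraph determines its center.) -/
noncomputable def stars (I : GraphInput n) (p : ℕ) : Finset (Fin n × Finset (Fin n)) :=
  Finset.univ.filter fun x => x.2.card = p ∧ ∀ w ∈ x.2, I.graph.Adj x.1 w

/-- `S_p`, the number of `p`-stars. -/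
noncomputable def starCount (I : GraphInput n) (p : ℕ) : ℕ := (I.stars p).card

theorem starCount_eq_sum (I : GraphInput n) (p : ℕ) :
    I.starCount p = ∑ v, (I.degree v).choose p := by
  classical
  have h : I.stars p = (Finset.univ.sigma
      (fun v => (I.graph.neighborFinset v).powersetCard p)).map
        (Equiv.sigmaEquivProd (Fin n) (Finset (Fin n))).toEmbedding := by
    ext ⟨v, L⟩
    simp [stars, Finset.mem_powersetCard, Finset.subset_iff, and_comm]
  rw [starCount, h, Finset.card_map, Finset.card_sigma]
  refine Finset.sum_congr rfl fun v _ => ?_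
  rw [Finset.card_powersetCard, degree, SimpleGraph.degree]

theorem degree_eq_length (I : GraphInput n) (v : Fin n) : I.degree v = (I.adj v).length := by
  classical
  have h : I.graph.neighborFinset v = (I.adj v).toFinset := by
    ext w
    simp [I.mem_adj]
  rw [← List.toFinset_card_of_nodup (I.nodup_adj v), ← h, degree, SimpleGraph.degree]

end GraphInput

/-- A deterministic adaptive algorithm on `n`-vertex inputs, as a decision tree: it either stops
with a real output or makes a query and continues according to the answer. -/
inductive QueryTree (n : ℕ) : Type
  | output (x : ℝ) : QueryTree n
  | degreeQuery (v : Fin n) (next : ℕ → QueryTree n) : QueryTree n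
  | neighborQuery (v : Fin n) (i : ℕ) (next : Option (Fin n) → QueryTree n) : QueryTree n
  | randomEdgeQuery (next : Option (Sym2 (Fin n)) → QueryTree n) : QueryTree n

namespace QueryTree

variable {n : ℕ}

/-- The law of the output on the input `I`; the answers to the random edge queries are independent
uniformly random edges. -/
noncomputable def outputLaw (I : GraphInput n) : QueryTree n → PMF ℝ
  | output x => PMF.pure x
  | degreeQuery v next => outputLaw I (next (I.degree v))
  | neighborQuery v i next => outputLaw I (next (I.neighbor v i))
  | randomEdgeQuery next => I.edgeLaw.bind fun e => outputLaw I (next e)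

/-- On the input `I` at most `q` queries are made, whatever the random edges turn out to be. -/
def QueriesLE (I : GraphInput n) : QueryTree n → ℕ → Prop
  | output _, _ => True
  | degreeQuery _ _, 0 => False
  | degreeQuery v next, q + 1 => QueriesLE I (next (I.degree v)) q
  | neighborQuery _ _ _, 0 => False
  | neighborQuery v i next, q + 1 => QueriesLE I (next (I.neighbor v i)) q
  | randomEdgeQuery _, 0 => False
  | randomEdgeQuery next, q + 1 => ∀ e ∈ I.edgeLaw.support, QueriesLE I (next e) q

end QueryTree

/-- A randomized algorithm on `n`-vertex inputs: a random seed, drawn from an arbitrary probability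
space, selects a deterministic algorithm; output probabilities depend measurably on the seed. -/
structure RandomizedAlgorithm (n : ℕ) where
  Seed : Type u
  [measurableSpace : MeasurableSpace Seed]
  seedLaw : Measure Seed
  [isProbabilityMeasure : IsProbabilityMeasure seedLaw]
  tree : Seed → QueryTree n
  measurable_outputLaw : ∀ I : GraphInput n,
    Measurable fun ω => ((tree ω).outputLaw I).toMeasure

namespace RandomizedAlgorithm

variable {n : ℕ}

/-- The law of the output on the input `I`, over the seed and the random edges. -/
noncomputable def outputLaw (A : RandomizedAlgorithm.{u} n) (I : GraphInput n) : Measure ℝ :=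
  letI := A.measurableSpace
  A.seedLaw.bind fun ω => ((A.tree ω).outputLaw I).toMeasure

/-- On the input `I` the algorithm almost surely makes at most `q` queries. -/
def QueriesLE (A : RandomizedAlgorithm.{u} n) (I : GraphInput n) (q : ℕ) : Prop :=
  letI := A.measurableSpace
  ∀ᵐ ω ∂A.seedLaw, (A.tree ω).QueriesLE I q

/-- On the input `I`, with probability at least `2/3`, the output approximates `S_p` to within the
multiplicative factor `lam`. -/
def Approximates (A : RandomizedAlgorithm.{u} n) (p : ℕ) (lam : ℝ) (I : GraphInput n) : Prop :=
  2 / 3 ≤ A.outputLaw I {x : ℝ | (I.starCount p : ℝ) / lam ≤ x ∧ x ≤ lam * I.starCount p}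

end RandomizedAlgorithm

/-! The lower bound hides one vertex of large degree. The base graph `I` contains `b` bipartite
blocks, each a `D`-regular circulant graph on two copies of `ZMod t`. A block splits into `D`
perfect matchings, one per difference, so there are `D * b` edge-disjoint matchings, and each has
its own reserved isolated vertex `c`. A switching replaces every edge `v w` of one matching by `v c`
and `w c`. Every vertex other than `c` keeps its degree and has at most one entry of its list
altered, while `c` acquires degree `2 * t` and adds `(2 * t).choose p` stars, enough to force a
different output.

A degree query notices only the switching centered at the queried vertex. A neighbor query notices
at most one more, the one whose matching contains the edge read. A random edge lies among the at
most `2 * t` new edges with probability at most `2 / (D * b)`, since there are at least `D * b * t`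
edges. Averaged over the switchings, each query therefore gains advantage at most `2 / (D * b)`
(`sum_outputLaw_le`), whereas a correct algorithm needs advantage `1 / 3`; thus `D * b ≤ 6 * q`
(`card_le_of_approximates_switch`).

It remains to make `D * b` large (`exists_hard_parameters`). With `x ^ p` of order `s`, a separate
star with about `x` leaves fixes the scale, and `t` is a large constant times `x`, so that the
hidden star dominates. Degree `D` about `x / n ^ (1 / p)` keeps the stars in the blocks below `x ^
p`, and `b` is about `n / t`, so `D * b` has order `n ^ (1 - 1 / p)`. -/

namespace QueryTree

/-! ### Hybrid argument on decision trees. -/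

variable {n : ℕ}

/-- If every degree or neighbor query distinguishes at most two of the inputs `J r` from `I`, and a
random edge query distinguishes each of them with advantage at most `2 / |R|`, then `q` queries
distinguish a uniformly random `J r` from `I` with advantage at most `2 * q / |R|`. -/
theorem sum_outputLaw_le {R : Type*} [Fintype R] [Nonempty R] (I : GraphInput n)
    (J : R → GraphInput n)
    (hdeg : ∀ v, {r | (J r).degree v ≠ I.degree v}.ncard ≤ 2)
    (hnbr : ∀ v i, {r | (J r).neighbor v i ≠ I.neighbor v i}.ncard ≤ 2)
    (hedge : ∀ r (f : Option (Sym2 (Fin n)) → ℝ≥0∞), (∀ e, f e ≤ 1) →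
      ∑' e, (J r).edgeLaw e * f e ≤ ∑' e, I.edgeLaw e * f e + 2 / Fintype.card R)
    {X : Set ℝ} (hX : MeasurableSet X) (T : QueryTree n) (q : ℕ) (hT : T.QueriesLE I q) :
    ∑ r, (T.outputLaw (J r)).toMeasure X ≤
      Fintype.card R * (T.outputLaw I).toMeasure X + 2 * q := by
  classical
  -- The at most two inputs that answer differently are given up at cost 1 each; the others continue
  -- in the same subtree as `I`.
  have key : ∀ (a b : R → ℝ≥0∞), (∀ r, a r ≤ 1) → {r | a r ≠ b r}.ncard ≤ 2 →
      ∑ r, a r ≤ ∑ r, b r + 2 := by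
    intro a b ha hab
    have h1 : ∀ r, a r ≤ b r + if a r ≠ b r then 1 else 0 := by
      intro r
      split_ifs with h
      · exact (ha r).trans le_add_self
      · rw [not_not] at h
        simp [h]
    refine (Finset.sum_le_sum fun r _ => h1 r).trans ?_
    rw [Finset.sum_add_distrib, Finset.sum_boole]
    gcongr
    rw [Set.ncard_eq_toFinset_card'] at hab
    simp only [Set.toFinset_ofPred] at hab
    exact_mod_cast hab
  have hle : ∀ (T : QueryTree n) (K : GraphInput n), (T.outputLaw K).toMeasure X ≤ 1 :=
    fun T K => prob_le_one
  induction T generalizing q with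
  | output x =>
    simp only [outputLaw, Finset.sum_const, Finset.card_univ, nsmul_eq_mul]
    exact le_self_add
  | degreeQuery v next ih =>
    cases q with
    | zero => exact hT.elim
    | succ q =>
      simp only [outputLaw]
      refine (key _ (fun r => ((next (I.degree v)).outputLaw (J r)).toMeasure X)
        (fun r => hle _ _) ?_).trans ?_
      · refine (Set.ncard_le_ncard ?_ (Set.toFinite _)).trans (hdeg v)
        intro r hr h
        exact hr (by simp only [h])
      · refine (add_le_add_left (ih _ q hT) 2).trans (le_of_eq ?_)
        push_cast
        ring
  | neighborQuery v i next ih =>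
    cases q with
    | zero => exact hT.elim
    | succ q =>
      simp only [outputLaw]
      refine (key _ (fun r => ((next (I.neighbor v i)).outputLaw (J r)).toMeasure X)
        (fun r => hle _ _) ?_).trans ?_
      · refine (Set.ncard_le_ncard ?_ (Set.toFinite _)).trans (hnbr v i)
        intro r hr h
        exact hr (by simp only [h])
      · refine (add_le_add_left (ih _ q hT) 2).trans (le_of_eq ?_)
        push_cast
        ring
  | randomEdgeQuery next ih =>
    cases q with
    | zero => exact hT.elim
    | succ q =>
      simp only [outputLaw, PMF.toMeasure_bind_apply _ _ _ hX]
      -- Drawing the edge from `I` instead costs `2 / |R|` for each `r`, hence 2 in total; all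
      -- inputs then share the answer and the induction hypothesis applies.
      refine (Finset.sum_le_sum fun r _ => hedge r _ fun e => hle _ _).trans ?_
      rw [Finset.sum_add_distrib, Finset.sum_const, Finset.card_univ, nsmul_eq_mul,
        ENNReal.mul_div_cancel (by simp) (by simp), ← Summable.tsum_finsetSum
          (fun _ _ => ENNReal.summable)]
      have h2 : ∀ e, ∑ r, I.edgeLaw e * ((next e).outputLaw (J r)).toMeasure X ≤
          Fintype.card R * (I.edgeLaw e * ((next e).outputLaw I).toMeasure X)
            + I.edgeLaw e * (2 * q) := by
        intro e
        rw [← Finset.mul_sum]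
        -- The query bound is known only for answers possible on `I`; the others have weight zero.
        by_cases he : e ∈ I.edgeLaw.support
        · refine (mul_le_mul_right (ih e q (hT e he)) _).trans (le_of_eq ?_)
          ring
        · rw [PMF.mem_support_iff, not_not] at he
          simp [he]
      refine (add_le_add_left (ENNReal.tsum_le_tsum h2) 2).trans (le_of_eq ?_)
      rw [ENNReal.tsum_add, ENNReal.tsum_mul_left, ENNReal.tsum_mul_right, PMF.tsum_coe]
      push_cast
      ring

end QueryTree

/-! ### Comparing random edges of two graphs. -/

namespace GraphInput

variable {n : ℕ}

open Classical in
/-- The finset of edges. -/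
noncomputable def edges (I : GraphInput n) : Finset (Sym2 (Fin n)) := I.graph.edgeFinset

theorem mk_mem_edges (I : GraphInput n) (v w : Fin n) :
    s(v, w) ∈ I.edges ↔ I.graph.Adj v w := by
  simp [edges]

theorem sum_degree (I : GraphInput n) : ∑ v, I.degree v = 2 * I.edges.card := by
  classical
  rw [edges, ← SimpleGraph.sum_degrees_eq_twice_card_edges]
  rfl

theorem tsum_edgeLaw_mul (I : GraphInput n) (hI : I.edges.Nonempty)
    (f : Option (Sym2 (Fin n)) → ℝ≥0∞) :
    ∑' e, I.edgeLaw e * f e = (∑ e ∈ I.edges, f (some e)) / I.edges.card := by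
  classical
  have h : I.edgeLaw = (PMF.uniformOfFinset I.edges hI).map some := by
    rw [edgeLaw, dif_pos]
    rfl
  have h1 : I.edgeLaw none = 0 := by
    rw [h, PMF.map_apply]
    simp
  have h2 : ∀ e, I.edgeLaw (some e) = if e ∈ I.edges then (I.edges.card : ℝ≥0∞)⁻¹ else 0 := by
    intro e
    rw [h, PMF.map_apply, tsum_eq_single e (by simp +contextual [eq_comm])]
    simp [PMF.uniformOfFinset_apply]
  rw [tsum_fintype, Fintype.sum_option, h1, zero_mul, zero_add]
  simp only [h2, ite_mul, zero_mul, Finset.sum_ite_mem, Finset.univ_inter]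
  rw [← Finset.mul_sum, mul_comm, div_eq_mul_inv]

/-- Comparison of the random edges of two graphs when the second one has at least as many edges. -/
theorem tsum_edgeLaw_mul_le (I J : GraphInput n) (hI : I.edges.Nonempty)
    (hcard : I.edges.card ≤ J.edges.card) (f : Option (Sym2 (Fin n)) → ℝ≥0∞)
    (hf : ∀ e, f e ≤ 1) :
    ∑' e, J.edgeLaw e * f e ≤
      ∑' e, I.edgeLaw e * f e + (J.edges \ I.edges).card / I.edges.card := by
  have hJ : J.edges.Nonempty := Finset.card_pos.1 (hI.card_pos.trans_le hcard)
  rw [tsum_edgeLaw_mul I hI, tsum_edgeLaw_mul J hJ, ← ENNReal.add_div]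
  -- More edges make each common edge less likely, so the excess comes only from new edges, each
  -- contributing at most 1 to the numerator.
  refine ENNReal.div_le_div ?_ (by exact_mod_cast hcard)
  rw [← Finset.sum_inter_add_sum_sdiff J.edges I.edges]
  refine add_le_add (Finset.sum_le_sum_of_subset Finset.inter_subset_right) ?_
  refine (Finset.sum_le_sum fun e _ => hf (some e)).trans ?_
  simp

end GraphInput

/-! ### Switching a matching onto an isolated vertex. -/

namespace GraphInput

variable {n : ℕ}

/-- The data of a switching: a matching of the graph, as the involution `σ` that exchanges the ends
of its edges, and an isolated vertex `c`. -/
structure IsSwitching (I : GraphInput n) (c : Fin n) (σ : Fin n → Fin n) : Prop where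
  isolated : ∀ v, ¬ I.graph.Adj c v
  involutive : Function.Involutive σ
  adj : ∀ v, σ v ≠ v → I.graph.Adj v (σ v)

namespace IsSwitching

variable {I : GraphInput n} {c : Fin n} {σ : Fin n → Fin n}

theorem apply_center (h : I.IsSwitching c σ) : σ c = c := by
  by_contra hc
  exact h.isolated _ (h.adj c hc)

end IsSwitching

open Classical in
/-- Replace every edge `v w` of the matching `σ` by the two edges `v c` and `w c`, keeping the
positions in the adjacency lists of `v` and `w`. -/
noncomputable def switch (I : GraphInput n) {c : Fin n} {σ : Fin n → Fin n}
    (h : I.IsSwitching c σ) : GraphInput n where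
  graph :=
    { Adj := fun x y => (x = c ∧ σ y ≠ y) ∨ (y = c ∧ σ x ≠ x) ∨ (I.graph.Adj x y ∧ y ≠ σ x)
      symm := ⟨by
        rintro x y (hx | hx | hx)
        · exact Or.inr (Or.inl hx)
        · exact Or.inl hx
        · refine Or.inr (Or.inr ⟨hx.1.symm, fun hxy => hx.2 ?_⟩)
          rw [hxy, h.involutive]⟩
      loopless := ⟨by
        rintro x (⟨rfl, hx⟩ | ⟨rfl, hx⟩ | hx)
        · exact hx h.apply_center
        · exact hx h.apply_center
        · exact I.graph.irrefl hx.1⟩ }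
  adj v := if v = c then (Finset.univ.filter fun w => σ w ≠ w).toList
    else (I.adj v).map fun w => if w = σ v then c else w
  nodup_adj v := by
    split_ifs with hv
    · exact Finset.nodup_toList _
    · refine (I.nodup_adj v).map_on ?_
      -- Since `c` was isolated, writing `c` over the partner of `v` creates no repetition.
      have hc : ∀ x ∈ I.adj v, x ≠ c := by
        rintro x hx rfl
        exact h.isolated v ((I.mem_adj _ _).1 hx).symm
      intro x hx y hy hxy
      split_ifs at hxy with h1 h2 h2
      · rw [h1, h2]
      · exact (hc y hy hxy.symm).elim
      · exact (hc x hx hxy).elim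
      · exact hxy
  mem_adj v w := by
    split_ifs with hv
    · subst hv
      simp only [Finset.mem_toList, Finset.mem_filter, Finset.mem_univ, true_and, h.isolated,
        false_and, or_false, h.apply_center, ne_eq, not_true_eq_false, and_false]
    · simp only [List.mem_map, I.mem_adj, hv, false_and, false_or]
      constructor
      · rintro ⟨x, hx, rfl⟩
        split_ifs with h1
        · refine Or.inl ⟨rfl, fun h2 => ?_⟩
          rw [h1, h2] at hx
          exact I.graph.irrefl hx
        · exact Or.inr ⟨hx, h1⟩
      · rintro (⟨rfl, hw⟩ | ⟨h1, h2⟩)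
        · exact ⟨σ v, h.adj v hw, by simp⟩
        · exact ⟨w, h1, by simp [h2]⟩

section

variable (I : GraphInput n) {c : Fin n} {σ : Fin n → Fin n} (h : I.IsSwitching c σ)

theorem degree_of_isolated (h : ∀ v, ¬ I.graph.Adj c v) : I.degree c = 0 := by
  rw [degree_eq_length, List.length_eq_zero_iff, List.eq_nil_iff_forall_not_mem]
  intro w hw
  exact h w ((I.mem_adj _ _).1 hw)

theorem degree_switch_of_ne {v : Fin n} (hv : v ≠ c) : (I.switch h).degree v = I.degree v := by
  simp [degree_eq_length, switch, hv]

theorem degree_switch_center : (I.switch h).degree c = {v | σ v ≠ v}.ncard := by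
  classical
  rw [degree_eq_length, Set.ncard_eq_toFinset_card']
  simp [switch]

/-- Here the preservation of list positions pays off: only the entry naming the partner of `v` is
overwritten. -/
theorem neighbor_switch_of_ne {v : Fin n} (hv : v ≠ c) {i : ℕ}
    (hi : I.neighbor v i ≠ some (σ v)) : (I.switch h).neighbor v i = I.neighbor v i := by
  simp only [neighbor, switch, hv, if_false, List.getElem?_map] at hi ⊢
  cases hw : (I.adj v)[i]? with
  | none => rfl
  | some w =>
    have : w ≠ σ v := fun hwv => hi (by rw [hw, hwv])
    simp [this]

theorem degree_le_degree_switch (v : Fin n) : I.degree v ≤ (I.switch h).degree v := by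
  by_cases hv : v = c
  · rw [hv, I.degree_of_isolated h.isolated]
    exact Nat.zero_le _
  · rw [degree_switch_of_ne I h hv]

/-- Each matched vertex trades its partner for `c`, so only the term of the center changes; it was
zero because `p ≠ 0`. -/
theorem starCount_switch {p : ℕ} (hp : p ≠ 0) :
    (I.switch h).starCount p = I.starCount p + ({v | σ v ≠ v}.ncard).choose p := by
  classical
  rw [starCount_eq_sum, starCount_eq_sum, ← Finset.add_sum_erase _ _ (Finset.mem_univ c),
    ← Finset.add_sum_erase Finset.univ (fun v => (I.degree v).choose p) (Finset.mem_univ c),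
    degree_switch_center, I.degree_of_isolated h.isolated, Nat.choose_eq_zero_of_lt
      (Nat.pos_of_ne_zero hp), zero_add, add_comm]
  congr 1
  refine Finset.sum_congr rfl fun v hv => ?_
  rw [degree_switch_of_ne I h (Finset.ne_of_mem_erase hv)]

/-- No degree decreases. This is the hypothesis under which random edges are compared one-sidedly.
-/
theorem card_edges_le_switch : I.edges.card ≤ (I.switch h).edges.card := by
  have h1 := I.sum_degree
  have h2 := (I.switch h).sum_degree
  have h3 : ∑ v, I.degree v ≤ ∑ v, (I.switch h).degree v :=
    Finset.sum_le_sum fun v _ => degree_le_degree_switch I h v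
  omega

/-- Every new edge joins the center to a moved vertex. -/
theorem card_edges_switch_sdiff_le :
    ((I.switch h).edges \ I.edges).card ≤ {v | σ v ≠ v}.ncard := by
  classical
  rw [Set.ncard_eq_toFinset_card']
  refine (Finset.card_le_card (t := {v | σ v ≠ v}.toFinset.image fun v => s(c, v)) ?_).trans
    Finset.card_image_le
  intro e
  induction e with
  | h x y =>
    simp only [Finset.mem_sdiff, mk_mem_edges, Finset.mem_image, Set.mem_toFinset,
      Set.mem_ofPred_eq]
    rintro ⟨h1 | h1 | h1, h2⟩
    · exact ⟨y, h1.2, by rw [h1.1]⟩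
    · exact ⟨x, h1.2, by rw [h1.1, Sym2.eq_swap]⟩
    · exact (h2 h1.1).elim

end

/-- The neighbor query `(v, i)` notices at most two switchings of a family with distinct centers
and disjoint matchings. -/
theorem ncard_neighbor_switch_ne_le {R : Type*} [Finite R] (I : GraphInput n) {c : R → Fin n}
    {σ : R → Fin n → Fin n} (h : ∀ r, I.IsSwitching (c r) (σ r)) (hc : Function.Injective c)
    (hσ : ∀ v r r', σ r v ≠ v → σ r v = σ r' v → r = r') (v : Fin n) (i : ℕ) :
    {r | (I.switch (h r)).neighbor v i ≠ I.neighbor v i}.ncard ≤ 2 := by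
  have hsub : {r | (I.switch (h r)).neighbor v i ≠ I.neighbor v i} ⊆
      {r | c r = v} ∪ {r | σ r v ≠ v ∧ I.neighbor v i = some (σ r v)} := by
    intro r hr
    by_cases hv : v = c r
    · exact Or.inl hv.symm
    · by_cases hi : I.neighbor v i = some (σ r v)
      -- If `σ r` fixed `v`, the entry read would be `v` itself, a loop.
      · refine Or.inr ⟨fun hrv => ?_, hi⟩
        have hm : v ∈ I.adj v := by
          rw [hrv] at hi
          exact List.mem_of_getElem? hi
        exact I.graph.irrefl ((I.mem_adj _ _).1 hm)
      · exact (hr (neighbor_switch_of_ne I (h r) hv hi)).elim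
  refine (Set.ncard_le_ncard hsub (Set.toFinite _)).trans ((Set.ncard_union_le _ _).trans ?_)
  refine add_le_add (b := 1) (d := 1) ?_ ?_
  · rw [Set.ncard_le_one (Set.toFinite _)]
    intro a ha b hb
    exact hc (ha.trans hb.symm)
  · rw [Set.ncard_le_one (Set.toFinite _)]
    intro a ha b hb
    exact hσ v a b ha.1 (Option.some_injective _ (ha.2.symm.trans hb.2))

theorem ncard_degree_switch_ne_le {R : Type*} [Finite R] (I : GraphInput n) {c : R → Fin n}
    {σ : R → Fin n → Fin n} (h : ∀ r, I.IsSwitching (c r) (σ r)) (hc : Function.Injective c)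
    (v : Fin n) : {r | (I.switch (h r)).degree v ≠ I.degree v}.ncard ≤ 2 := by
  have hsub : {r | (I.switch (h r)).degree v ≠ I.degree v} ⊆ {r | c r = v} := by
    intro r hr
    by_contra hv
    exact hr (degree_switch_of_ne I (h r) (Ne.symm hv))
  refine (Set.ncard_le_ncard hsub (Set.toFinite _)).trans ?_
  refine le_trans ?_ one_le_two
  rw [Set.ncard_le_one (Set.toFinite _)]
  intro a ha b hb
  exact hc (ha.trans hb.symm)

end GraphInput

/-! ### From distinguishing advantage to a query bound. -/

namespace RandomizedAlgorithm

variable {n : ℕ}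

theorem outputLaw_apply (A : RandomizedAlgorithm.{u} n) (I : GraphInput n) {X : Set ℝ}
    (hX : MeasurableSet X) :
    letI := A.measurableSpace
    A.outputLaw I X = ∫⁻ ω, ((A.tree ω).outputLaw I).toMeasure X ∂A.seedLaw := by
  let _ := A.measurableSpace
  exact Measure.bind_apply hX (A.measurable_outputLaw I).aemeasurable

theorem outputLaw_univ (A : RandomizedAlgorithm.{u} n) (I : GraphInput n) :
    A.outputLaw I Set.univ = 1 := by
  let _ := A.measurableSpace
  have := A.isProbabilityMeasure
  rw [outputLaw_apply A I MeasurableSet.univ]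
  simp

/-- An algorithm that approximates the number of stars on `I` and on all members of a family of
switchings with distinct centers and disjoint matchings makes many queries on `I`. -/
theorem card_le_of_approximates_switch {R : Type*} [Fintype R] [Nonempty R] (I : GraphInput n)
    {c : R → Fin n} {σ : R → Fin n → Fin n} (h : ∀ r, I.IsSwitching (c r) (σ r))
    (hc : Function.Injective c) (hσ : ∀ v r r', σ r v ≠ v → σ r v = σ r' v → r = r')
    {t : ℕ} (ht : 0 < t) (hmoved : ∀ r, {v | σ r v ≠ v}.ncard = 2 * t)
    (hedges : Fintype.card R * t ≤ I.edges.card)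
    {p : ℕ} (hp : p ≠ 0) {lam : ℝ} (hlam : 1 ≤ lam) (hI : 0 < I.starCount p)
    (hgap : lam ^ 2 * I.starCount p ≤ ((2 * t).choose p : ℕ))
    (A : RandomizedAlgorithm.{u} n) {q : ℕ} (hA : A.Approximates p lam I)
    (hAs : ∀ r, A.Approximates p lam (I.switch (h r))) (hq : A.QueriesLE I q) :
    Fintype.card R ≤ 6 * q := by
  let _ := A.measurableSpace
  have := A.isProbabilityMeasure
  set k := Fintype.card R with hk
  have hk0 : 0 < k := Fintype.card_pos
  set S := I.starCount p with hS
  set S' := S + (2 * t).choose p with hS'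
  set X : Set ℝ := {x | (S' : ℝ) / lam ≤ x ∧ x ≤ lam * S'} with hXdef
  have hX : MeasurableSet X := measurableSet_Icc
  have hSr : ∀ r, (I.switch (h r)).starCount p = S' := by
    intro r
    rw [GraphInput.starCount_switch I (h r) hp, hmoved]
  have hXr : ∀ r, 2 / 3 ≤ A.outputLaw (I.switch (h r)) X := by
    intro r
    have := hAs r
    rw [Approximates, hSr] at this
    exact this
  have hX0 : A.outputLaw I X ≤ 1 / 3 := by
    set Y : Set ℝ := {x | (S : ℝ) / lam ≤ x ∧ x ≤ lam * S} with hYdef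
    -- A common point would give `S' ≤ lam ^ 2 * S`, while `S' ≥ S + lam ^ 2 * S` and `S > 0`.
    have hdisj : Disjoint X Y := by
      rw [Set.disjoint_left]
      rintro x ⟨hx1, -⟩ ⟨-, hx2⟩
      have h1 : (S' : ℝ) / lam ≤ lam * S := hx1.trans hx2
      rw [div_le_iff₀ (by linarith)] at h1
      have h2 : (0 : ℝ) < S := by exact_mod_cast hI
      rw [hS'] at h1
      push_cast at h1
      nlinarith
    have hY : MeasurableSet Y := measurableSet_Icc
    have h1 : A.outputLaw I X + A.outputLaw I Y ≤ 1 := by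
      rw [← measure_union hdisj hY, ← outputLaw_univ A I]
      exact measure_mono (Set.subset_univ _)
    have h2 : A.outputLaw I X + 2 / 3 ≤ 1 := le_trans (by gcongr; exact hA) h1
    have h3 : (1 : ℝ≥0∞) = 1 / 3 + 2 / 3 := by
      rw [← ENNReal.add_div, show (1 : ℝ≥0∞) + 2 = 3 by norm_num,
        ENNReal.div_self (by norm_num) (by norm_num)]
    rw [h3] at h2
    exact (ENNReal.add_le_add_iff_right
      (ENNReal.div_ne_top (by norm_num) (by norm_num))).1 h2
  have hE : I.edges.Nonempty := Finset.card_pos.1 ((Nat.mul_pos hk0 ht).trans_le hedges)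
  have hedge : ∀ r (f : Option (Sym2 (Fin n)) → ℝ≥0∞), (∀ e, f e ≤ 1) →
      ∑' e, (I.switch (h r)).edgeLaw e * f e ≤ ∑' e, I.edgeLaw e * f e + 2 / k := by
    intro r f hf
    refine (GraphInput.tsum_edgeLaw_mul_le I _ hE
      (GraphInput.card_edges_le_switch I (h r)) f hf).trans ?_
    refine add_le_add le_rfl ?_
    have h1 : ((I.switch (h r)).edges \ I.edges).card ≤ 2 * t :=
      (GraphInput.card_edges_switch_sdiff_le I (h r)).trans (hmoved r).le
    calc (((I.switch (h r)).edges \ I.edges).card : ℝ≥0∞) / I.edges.card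
        ≤ ((2 * t : ℕ) : ℝ≥0∞) / ((k * t : ℕ) : ℝ≥0∞) := by
          refine ENNReal.div_le_div ?_ ?_
          · exact_mod_cast h1
          · exact_mod_cast hedges
      _ = 2 / k := by
          push_cast
          exact ENNReal.mul_div_mul_right _ _ (by exact_mod_cast ht.ne') (by simp)
  have hsum : ∑ r, A.outputLaw (I.switch (h r)) X ≤ k * A.outputLaw I X + 2 * q := by
    simp only [outputLaw_apply A _ hX]
    have hm : ∀ K : GraphInput n,
        Measurable fun ω => ((A.tree ω).outputLaw K).toMeasure X := fun K =>
      (Measure.measurable_coe hX).comp (A.measurable_outputLaw K)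
    rw [← lintegral_finsetSum _ fun r _ => hm _, ← lintegral_const_mul _ (hm I)]
    have h2 : (2 * q : ℝ≥0∞) = ∫⁻ _, 2 * q ∂A.seedLaw := by simp
    rw [h2, ← lintegral_add_right _ measurable_const]
    refine lintegral_mono_ae ?_
    filter_upwards [hq] with ω hω
    exact QueryTree.sum_outputLaw_le I _ (GraphInput.ncard_degree_switch_ne_le I h hc)
      (GraphInput.ncard_neighbor_switch_ne_le I h hc hσ) hedge hX _ q hω
  -- The window `X` has probability at least `2 / 3` on each switched input and at most `1 / 3` on
  -- `I`.
  have hfin : (k : ℝ≥0∞) * (2 / 3) ≤ k * (1 / 3) + 2 * q := by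
    calc (k : ℝ≥0∞) * (2 / 3) = ∑ _r : R, 2 / 3 := by simp [hk]
      _ ≤ ∑ r, A.outputLaw (I.switch (h r)) X := Finset.sum_le_sum fun r _ => hXr r
      _ ≤ k * A.outputLaw I X + 2 * q := hsum
      _ ≤ k * (1 / 3) + 2 * q := by gcongr
  have h3 := ENNReal.toReal_mono (by finiteness) hfin
  rw [ENNReal.toReal_add (by finiteness) (by finiteness)] at h3
  simp only [ENNReal.toReal_mul, ENNReal.toReal_div, ENNReal.toReal_natCast,
    ENNReal.toReal_ofNat, ENNReal.toReal_one] at h3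
  have h4 : (k : ℝ) ≤ 6 * q := by linarith
  exact_mod_cast h4

end RandomizedAlgorithm

/-! ### The hard graph and its matchings. -/

namespace GraphInput

variable {n : ℕ}

open Classical in
/-- A graph on a type equivalent to `Fin n` as an input, with some order of the adjacency lists. -/
noncomputable def ofGraph {V : Type*} (φ : Fin n ≃ V) (G : SimpleGraph V) : GraphInput n where
  graph := G.comap φ
  adj v := ((G.comap φ).neighborFinset v).toList
  nodup_adj v := Finset.nodup_toList _
  mem_adj v w := by simp

theorem degree_ofGraph {V : Type*} (φ : Fin n ≃ V) (G : SimpleGraph V) (v : Fin n) :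
    (ofGraph φ G).degree v = (G.neighborSet (φ v)).ncard := by
  classical
  have h : G.neighborSet (φ v) = φ '' ((G.comap φ).neighborSet v) := by
    ext x
    simp
  rw [h, Set.ncard_image_of_injective _ φ.injective, Set.ncard_eq_toFinset_card']
  rfl

end GraphInput

/-- The vertices of the hard graph: those of a star with `d` leaves, those of `b` bipartite blocks
with both sides equal to `ZMod t`, a reserved isolated vertex for every element of `U` and every
block, and `e` further isolated vertices. -/
abbrev HardVertex (d b t : ℕ) (U : Finset (ZMod t)) (e : ℕ) : Type :=
  Option (Fin d) ⊕ (Fin b × ZMod t × Bool) ⊕ (U × Fin b) ⊕ Fin e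

namespace HardVertex

variable {d b t : ℕ} {U : Finset (ZMod t)} {e : ℕ}

/-- Adjacency in the hard graph: the star, and a circulant bipartite graph with the differences in
`U` on each block. -/
def Adj : HardVertex d b t U e → HardVertex d b t U e → Prop
  | .inl none, .inl (some _) => True
  | .inl (some _), .inl none => True
  | .inr (.inl (w, z, false)), .inr (.inl (w', z', true)) => w = w' ∧ z' - z ∈ U
  | .inr (.inl (w, z, true)), .inr (.inl (w', z', false)) => w = w' ∧ z - z' ∈ U
  | _, _ => False

/-- The hard graph. -/
def graph (d b t : ℕ) (U : Finset (ZMod t)) (e : ℕ) : SimpleGraph (HardVertex d b t U e) where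
  Adj := Adj
  symm := ⟨by
    rintro ((_ | x) | ⟨w, z, (_ | _)⟩ | x | x) ((_ | y) | ⟨w', z', (_ | _)⟩ | y | y) h <;>
      simp_all [Adj]⟩
  loopless := ⟨by
    rintro ((_ | x) | ⟨w, z, (_ | _)⟩ | x | x) h <;> simp_all [Adj]⟩

/-- The matching of difference `r.1` in the block `r.2`, as an involution. -/
def swap (r : U × Fin b) : HardVertex d b t U e → HardVertex d b t U e
  | .inr (.inl (w, z, false)) =>
    if w = r.2 then .inr (.inl (w, z + r.1, true)) else .inr (.inl (w, z, false))
  | .inr (.inl (w, z, true)) =>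
    if w = r.2 then .inr (.inl (w, z - r.1, false)) else .inr (.inl (w, z, true))
  | x => x

theorem swap_involutive (r : U × Fin b) :
    Function.Involutive (swap r : HardVertex d b t U e → HardVertex d b t U e) := by
  rintro ((_ | x) | ⟨w, z, (_ | _)⟩ | x | x) <;> simp only [swap] <;> split_ifs with h <;>
    simp [h]

theorem adj_swap (r : U × Fin b) (x : HardVertex d b t U e) (hx : swap r x ≠ x) :
    (graph d b t U e).Adj x (swap r x) := by
  obtain ((_ | x) | ⟨w, z, (_ | _)⟩ | x | x) := x <;> simp only [swap] at hx ⊢ <;>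
    first
    | exact (hx rfl).elim
    | (split_ifs at hx ⊢ with h
       · simp [graph, Adj]
       · exact (hx rfl).elim)

/-- The image of one moved vertex reveals both the block and the difference, so the matchings are
edge-disjoint. -/
theorem swap_eq_swap {r r' : U × Fin b} {x : HardVertex d b t U e} (hx : swap r x ≠ x)
    (h : swap r x = swap r' x) : r = r' := by
  obtain ((_ | x) | ⟨w, z, (_ | _)⟩ | x | x) := x <;> simp only [swap] at hx h <;>
    first
    | exact (hx rfl).elim
    | (split_ifs at hx h with h1 h2 h2
       · refine Prod.ext (Subtype.ext ?_) (h1.symm.trans h2)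
         simpa using h
       · exact (hx h).elim
       · exact (hx rfl).elim
       · exact (hx rfl).elim)

/-- Each matching is perfect on its block and fixes everything else. -/
theorem ncard_swap_ne [NeZero t] (r : U × Fin b) :
    {x : HardVertex d b t U e | swap r x ≠ x}.ncard = 2 * t := by
  have h : {x : HardVertex d b t U e | swap r x ≠ x} =
      Set.range fun y : ZMod t × Bool => .inr (.inl (r.2, y)) := by
    ext x
    obtain ((_ | x) | ⟨w, z, (_ | _)⟩ | x | x) := x <;> simp [swap, eq_comm]
  rw [h, ← Set.image_univ, Set.ncard_image_of_injective, Set.ncard_univ, Nat.card_eq_fintype_card]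
  · simp [ZMod.card, mul_comm]
  · intro x y hxy
    simpa using hxy

theorem ncard_neighborSet_center :
    ((graph d b t U e).neighborSet (.inl none)).ncard = d := by
  have h : (graph d b t U e).neighborSet (.inl none) =
      Set.range fun i : Fin d => .inl (some i) := by
    ext x
    obtain ((_ | x) | ⟨w, z, (_ | _)⟩ | x | x) := x <;> simp [graph, Adj]
  rw [h, ← Set.image_univ, Set.ncard_image_of_injective, Set.ncard_univ, Nat.card_eq_fintype_card]
  · simp
  · intro x y hxy
    simpa using hxy

theorem ncard_neighborSet_leaf (i : Fin d) :
    ((graph d b t U e).neighborSet (.inl (some i))).ncard = 1 := by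
  rw [Set.ncard_eq_one]
  refine ⟨.inl none, ?_⟩
  ext x
  obtain ((_ | x) | ⟨w, z, (_ | _)⟩ | x | x) := x <;> simp [graph, Adj]

theorem ncard_neighborSet_block (x : Fin b × ZMod t × Bool) :
    ((graph d b t U e).neighborSet (.inr (.inl x))).ncard = U.card := by
  obtain ⟨w, z, (_ | _)⟩ := x
  · have h : (graph d b t U e).neighborSet (.inr (.inl (w, z, false))) =
        (fun u => .inr (.inl (w, z + u, true))) '' (U : Set (ZMod t)) := by
      ext x
      obtain ((_ | x) | ⟨w', z', (_ | _)⟩ | x | x) := x <;> simp [graph, Adj]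
      constructor
      · rintro ⟨rfl, h⟩
        exact ⟨_, h, rfl, by simp⟩
      · rintro ⟨u, hu, rfl, rfl⟩
        simpa using hu
    rw [h, Set.ncard_image_of_injective, Set.ncard_coe_finset]
    intro x y hxy
    simpa using hxy
  · have h : (graph d b t U e).neighborSet (.inr (.inl (w, z, true))) =
        (fun u => .inr (.inl (w, z - u, false))) '' (U : Set (ZMod t)) := by
      ext x
      obtain ((_ | x) | ⟨w', z', (_ | _)⟩ | x | x) := x <;> simp [graph, Adj]
      constructor
      · rintro ⟨rfl, h⟩
        exact ⟨_, h, rfl, by simp⟩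
      · rintro ⟨u, hu, rfl, rfl⟩
        simpa using hu
    rw [h, Set.ncard_image_of_injective, Set.ncard_coe_finset]
    intro x y hxy
    simpa using hxy

theorem not_adj_reserved (x : (U × Fin b) ⊕ Fin e) (y : HardVertex d b t U e) :
    ¬ (graph d b t U e).Adj (.inr (.inr x)) y := by
  obtain ((_ | y) | ⟨w', z', (_ | _)⟩ | y | y) := y <;> simp [graph, Adj]

theorem ncard_neighborSet_reserved (x : (U × Fin b) ⊕ Fin e) :
    ((graph d b t U e).neighborSet (.inr (.inr x))).ncard = 0 := by
  have h : (graph d b t U e).neighborSet (.inr (.inr x)) = ∅ :=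
    Set.eq_empty_of_forall_notMem fun y => not_adj_reserved x y
  rw [h, Set.ncard_empty]

/-- The sum of a function of the degrees over all vertices of the hard graph. -/
theorem sum_degree_ofGraph [NeZero t] {n : ℕ} (φ : Fin n ≃ HardVertex d b t U e) (f : ℕ → ℕ)
    (hf : f 0 = 0) :
    ∑ v, f ((GraphInput.ofGraph φ (graph d b t U e)).degree v) =
      f d + d * f 1 + 2 * (b * t) * f U.card := by
  simp only [GraphInput.degree_ofGraph]
  rw [Equiv.sum_comp φ fun x => f ((graph d b t U e).neighborSet x).ncard,
    Fintype.sum_sum_type, Fintype.sum_sum_type, Fintype.sum_option]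
  simp only [ncard_neighborSet_center, ncard_neighborSet_leaf, ncard_neighborSet_block,
    ncard_neighborSet_reserved, hf, Finset.sum_const, Finset.card_univ, Fintype.card_prod,
    Fintype.card_fin, ZMod.card, Fintype.card_bool, smul_eq_mul, mul_zero, add_zero]
  ring

theorem isSwitching {n : ℕ} (φ : Fin n ≃ HardVertex d b t U e) (r : U × Fin b) :
    (GraphInput.ofGraph φ (graph d b t U e)).IsSwitching (φ.symm (.inr (.inr (.inl r))))
      fun v => φ.symm (swap r (φ v)) where
  isolated v hv := by
    simp only [GraphInput.ofGraph, SimpleGraph.comap_adj, Equiv.apply_symm_apply] at hv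
    exact not_adj_reserved _ _ hv
  involutive v := by simp [swap_involutive r (φ v)]
  adj v hv := by
    simp only [GraphInput.ofGraph, SimpleGraph.comap_adj, Equiv.apply_symm_apply]
    exact adj_swap r _ fun h => hv (by rw [h, Equiv.symm_apply_apply])

end HardVertex

/-! ### The bound on the hard family and the choice of parameters. -/

/-- A lower bound for algorithms that approximate the number of `p`-stars on an `n`-vertex graph
made of a star with `d` leaves and of `b` bipartite `D`-regular blocks with `2 * t` vertices, and on
all graphs with `(2 * t).choose p` stars more. -/
theorem RandomizedAlgorithm.mul_le_of_approximates {n d b t D p : ℕ} (hp : 2 ≤ p) (ht : 0 < t)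
    (hb : 0 < b) (hD : 0 < D) (hDt : D ≤ t) (hn : 1 + d + 2 * (b * t) + D * b ≤ n) {lam : ℝ}
    (hlam : 1 ≤ lam) (hd : p ≤ d)
    (hgap : lam ^ 2 * (d.choose p + 2 * (b * t) * D.choose p : ℕ) ≤ ((2 * t).choose p : ℕ))
    (A : RandomizedAlgorithm.{u} n) {q : ℕ}
    (hA : ∀ I : GraphInput n, d.choose p ≤ I.starCount p →
      I.starCount p ≤ d.choose p + 2 * (b * t) * D.choose p + (2 * t).choose p →
        A.Approximates p lam I ∧ A.QueriesLE I q) :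
    D * b ≤ 6 * q := by
  classical
  have : NeZero t := ⟨ht.ne'⟩
  obtain ⟨U, -, hU⟩ := Finset.exists_subset_card_eq
    (s := (Finset.univ : Finset (ZMod t))) (n := D) (by simpa [ZMod.card] using hDt)
  obtain ⟨e, rfl⟩ := Nat.exists_eq_add_of_le hn
  have hcard : Fintype.card (Fin (1 + d + 2 * (b * t) + D * b + e)) =
      Fintype.card (HardVertex d b t U e) := by
    simp only [Fintype.card_sum, Fintype.card_option, Fintype.card_prod, Fintype.card_fin,
      ZMod.card, Fintype.card_bool, Fintype.card_coe, hU]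
    ring
  let φ := Fintype.equivOfCardEq hcard
  set I := GraphInput.ofGraph φ (HardVertex.graph d b t U e) with hI
  have hS : I.starCount p = d.choose p + 2 * (b * t) * D.choose p := by
    rw [GraphInput.starCount_eq_sum, HardVertex.sum_degree_ofGraph φ (fun k => k.choose p)
      (Nat.choose_eq_zero_of_lt (by omega)), hU, Nat.choose_eq_zero_of_lt (n := 1) (by omega)]
    simp
  -- The block vertices alone contribute `2 * (b * t) * D` to the degree sum.
  have hE : D * b * t ≤ I.edges.card := by
    have h1 := I.sum_degree
    rw [HardVertex.sum_degree_ofGraph φ (fun k => k) rfl, hU] at h1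
    nlinarith
  have hR : Fintype.card (U × Fin b) = D * b := by simp [hU]
  have hne : Nonempty (U × Fin b) := by
    rw [← Fintype.card_pos_iff, hR]
    positivity
  have hmoved : ∀ r : U × Fin b, {v | φ.symm (HardVertex.swap r (φ v)) ≠ v}.ncard = 2 * t := by
    intro r
    rw [← HardVertex.ncard_swap_ne (d := d) (e := e) r,
      ← Set.ncard_image_of_injective _ φ.injective]
    congr 1
    ext x
    simp [Equiv.symm_apply_eq]
  have hSr : ∀ r, (I.switch (HardVertex.isSwitching φ r)).starCount p =
      d.choose p + 2 * (b * t) * D.choose p + (2 * t).choose p := by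
    intro r
    rw [GraphInput.starCount_switch I _ (by omega), hmoved, hS]
  rw [← hR]
  refine RandomizedAlgorithm.card_le_of_approximates_switch I (HardVertex.isSwitching φ) ?_ ?_ ht
    hmoved (by rw [hR]; exact hE) (by omega) hlam ?_ (by rw [hS]; exact hgap) A
    (hA I (by omega) (by omega)).1
    (fun r => (hA _ (by rw [hSr]; omega) (by rw [hSr])).1) (hA I (by omega) (by omega)).2
  · intro r r' h
    simpa using h
  · intro v r r' h1 h2
    refine HardVertex.swap_eq_swap (x := φ v) (fun h => h1 ?_) (φ.symm.injective h2)
    rw [h, Equiv.symm_apply_apply]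
  · rw [hS]
    exact Nat.add_pos_left (Nat.choose_pos hd) _

/-- The parameters of the hard graphs: `x ^ p` is the order of magnitude of the number of stars, and
the degree `D` in the blocks is about `x / n ^ (1 / p)`. -/
theorem exists_hard_parameters {p B E n x : ℕ} (hp : 2 ≤ p) (hB : p + 2 ≤ B)
    (hE : (p + 1) ^ p + 1 ≤ E) {lam : ℝ} (hBlam : lam ^ 2 * p.factorial * E ≤ B) (hx : 0 < x)
    (hxn : 16 * (B * x) ≤ n) :
    ∃ d b t D : ℕ, 0 < t ∧ 0 < b ∧ 0 < D ∧ D ≤ t ∧ 1 + d + 2 * (b * t) + D * b ≤ n ∧ p ≤ d ∧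
      lam ^ 2 * (d.choose p + 2 * (b * t) * D.choose p : ℕ) ≤ ((2 * t).choose p : ℕ) ∧
      x ^ p ≤ p.factorial * d.choose p ∧
      d.choose p + 2 * (b * t) * D.choose p + (2 * t).choose p ≤ (E + (2 * B) ^ p) * x ^ p ∧
      (n : ℝ) / (n : ℝ) ^ (1 / (p : ℝ)) ≤ 32 * B * (D * b : ℕ) := by
  have hB0 : 0 < B := by omega
  set t := B * x with ht
  have ht0 : 0 < t := Nat.mul_pos hB0 hx
  have hn0 : 0 < n := by omega
  set b := n / (8 * t) with hb
  have hb0 : 0 < b := Nat.div_pos (by omega) (by omega)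
  have hbt : 8 * (b * t) ≤ n := by
    have := Nat.div_mul_le_self n (8 * t)
    rw [← hb] at this
    nlinarith
  -- Rounding down loses at most a factor 2, as `b ≥ 1`.
  have hnb : n ≤ 16 * (b * t) := by
    have := Nat.lt_mul_div_succ n (show 0 < 8 * t by omega)
    rw [← hb] at this
    nlinarith
  have hn1 : (1 : ℝ) ≤ n := by exact_mod_cast hn0
  set h : ℝ := (n : ℝ) ^ (1 / (p : ℝ)) with hh
  have hh1 : 1 ≤ h := Real.one_le_rpow hn1 (by positivity)
  have hhp : h ^ p = n := by
    rw [hh, one_div]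
    exact Real.rpow_inv_natCast_pow (by positivity) (by omega)
  have hxh : (0 : ℝ) ≤ x / h := by positivity
  -- For small `x` the degree is raised to 1: the blocks become single matchings, which contain no
  -- `p`-star because `p ≥ 2`.
  set D := max 1 ⌊(x : ℝ) / h⌋₊ with hD
  have hDx : D ≤ x := by
    refine max_le hx (Nat.floor_le_of_le ?_)
    exact div_le_self (by positivity) hh1
  have hxt : x ≤ t := Nat.le_mul_of_pos_left _ hB0
  have hpt : 1 + (x + p) ≤ t := by nlinarith
  have hDb : D * b ≤ b * t := by nlinarith [hDx.trans hxt]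
  have hfirst : (x + p).choose p ≤ (p + 1) ^ p * x ^ p := by
    rw [← mul_pow]
    refine (Nat.choose_le_pow _ _).trans (Nat.pow_le_pow_left ?_ _)
    nlinarith
  have hsecond : 2 * (b * t) * D.choose p ≤ x ^ p := by
    rcases le_or_gt ⌊(x : ℝ) / h⌋₊ 1 with h1 | h1
    · rw [hD, max_eq_left h1, Nat.choose_eq_zero_of_lt (by omega)]
      simp
    · have hDeq : D = ⌊(x : ℝ) / h⌋₊ := max_eq_right h1.le
      have h2 : (D : ℝ) * h ≤ x := by
        rw [← le_div_iff₀ (by linarith), hDeq]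
        exact Nat.floor_le hxh
      have h3 : (D : ℝ) ^ p * n ≤ (x : ℝ) ^ p := by
        rw [← hhp, ← mul_pow]
        exact pow_le_pow_left₀ (by positivity) h2 p
      have h4 : D ^ p * n ≤ x ^ p := by exact_mod_cast h3
      refine le_trans ?_ h4
      rw [mul_comm]
      exact Nat.mul_le_mul (Nat.choose_le_pow _ _) (by omega)
  have hS : (x + p).choose p + 2 * (b * t) * D.choose p ≤ E * x ^ p := by
    refine le_trans ?_ (Nat.mul_le_mul_right _ hE)
    rw [add_mul, one_mul]
    exact add_le_add hfirst hsecond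
  -- Taking `x + p` leaves ensures both `p ≤ d` and `x ^ p ≤ p! * d.choose p`. The vertices number
  -- at most `4 * (b * t) ≤ n`.
  refine ⟨x + p, b, t, D, ht0, hb0, by omega, hDx.trans hxt, by omega, by omega, ?_, ?_, ?_, ?_⟩
  -- Here `2 * t + 1 - p ≥ t = B * x`; a single factor `B` of `B ^ p` then pays for `lam ^ 2 * p! *
  -- E`.
  · have h1 : (B * x) ^ p ≤ p.factorial * (2 * t).choose p := by
      have h2 : ((2 * t + 1 - p : ℕ) ^ p : ℚ) ≤ (p.factorial * (2 * t).choose p : ℚ) := by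
        have := Nat.pow_le_choose (α := ℚ) p (2 * t)
        rwa [div_le_iff₀' (by positivity)] at this
      have h3 : (2 * t + 1 - p) ^ p ≤ p.factorial * (2 * t).choose p := by exact_mod_cast h2
      exact (Nat.pow_le_pow_left (by omega) p).trans h3
    have h2 : (B : ℝ) * x ^ p ≤ p.factorial * ((2 * t).choose p : ℕ) := by
      have h3 : B * x ^ p ≤ (B * x) ^ p := by
        rw [mul_pow]
        exact Nat.mul_le_mul_right _ (Nat.le_self_pow (by omega) B)
      exact_mod_cast h3.trans h1
    have hf : (0 : ℝ) < p.factorial := by positivity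
    have h4 : (((x + p).choose p + 2 * (b * t) * D.choose p : ℕ) : ℝ) ≤ E * (x : ℝ) ^ p := by
      exact_mod_cast hS
    refine le_of_mul_le_mul_left ?_ hf
    refine le_trans ?_ h2
    calc (p.factorial : ℝ) * (lam ^ 2 * ((x + p).choose p + 2 * (b * t) * D.choose p : ℕ))
        ≤ p.factorial * (lam ^ 2 * (E * (x : ℝ) ^ p)) := by gcongr
      _ = (lam ^ 2 * p.factorial * E) * (x : ℝ) ^ p := by ring
      _ ≤ B * (x : ℝ) ^ p := by gcongr
  · have h2 : ((x + p + 1 - p : ℕ) ^ p : ℚ) ≤ (p.factorial * (x + p).choose p : ℚ) := by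
      have := Nat.pow_le_choose (α := ℚ) p (x + p)
      rwa [div_le_iff₀' (by positivity)] at this
    have h3 : (x + p + 1 - p) ^ p ≤ p.factorial * (x + p).choose p := by exact_mod_cast h2
    exact (Nat.pow_le_pow_left (by omega) p).trans h3
  · rw [add_mul, ← mul_pow]
    refine add_le_add hS ((Nat.choose_le_pow _ _).trans (le_of_eq ?_))
    rw [ht, mul_assoc]
  · have h1 : (x : ℝ) / h ≤ 2 * D := by
      have h2 := (Nat.lt_floor_add_one ((x : ℝ) / h)).le
      have h3 : ((⌊(x : ℝ) / h⌋₊ + 1 : ℕ) : ℝ) ≤ (2 * D : ℕ) := by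
        exact_mod_cast (show ⌊(x : ℝ) / h⌋₊ + 1 ≤ 2 * D by omega)
      push_cast at h3
      linarith
    have h4 : (n : ℝ) ≤ 16 * (b * (B * x)) := by exact_mod_cast hnb
    calc (n : ℝ) / h ≤ 16 * (b * (B * x)) / h := by gcongr
      _ = 16 * B * b * (x / h) := by ring
      _ ≤ 16 * B * b * (2 * D) := by gcongr
      _ = 32 * B * (D * b : ℕ) := by
        push_cast
        ring

theorem mainTheorem4 (p : ℕ) (hp : 2 ≤ p) (lam C : ℝ) (hlam : 1 ≤ lam) (hC : 0 < C) :
    ∃ K c : ℝ, 1 ≤ K ∧ 0 < c ∧ ∃ N : ℕ, ∀ n : ℕ, N ≤ n →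
      ∀ s : ℝ, 1 ≤ s → s ≤ C * (n : ℝ) ^ p →
        ∀ (A : RandomizedAlgorithm.{u} n) (q : ℕ),
          (∀ I : GraphInput n, s / K ≤ I.starCount p → I.starCount p ≤ K * s →
            A.Approximates p lam I ∧ A.QueriesLE I q) →
          c * (n : ℝ) ^ (1 - 1 / (p : ℝ)) ≤ q := by
  set E : ℕ := (p + 1) ^ p + 1 with hE
  set B : ℕ := ⌈lam ^ 2 * p.factorial * E⌉₊ + (p + 2) with hB
  have hBlam : lam ^ 2 * p.factorial * E ≤ B := by
    refine (Nat.le_ceil _).trans ?_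
    exact_mod_cast Nat.le_add_right _ _
  have hB1 : (1 : ℝ) ≤ B := by exact_mod_cast (show 1 ≤ B by omega)
  set C' : ℝ := C ^ (1 / (p : ℝ)) with hC'
  have hC'0 : 0 < C' := Real.rpow_pos_of_pos hC _
  have hC'p : C' ^ p = C := by
    rw [hC', one_div]
    exact Real.rpow_inv_natCast_pow hC.le (by omega)
  -- Chosen so that `32 * B * (δ * y) = y / (C' + 1) ≤ n`, by `y ≤ C' * n`; this is where `s ≤ C * n
  -- ^ p` enters.
  set δ : ℝ := 1 / (32 * B * (C' + 1)) with hδ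
  have hδ0 : 0 < δ := by positivity
  have hδ1 : δ ≤ 1 := by
    rw [hδ, div_le_one (by positivity)]
    nlinarith
  -- The second term absorbs the loss in the lower bound on the star counts, the third that in the
  -- upper bound.
  set K : ℝ := 1 + p.factorial / δ ^ p + (E + (2 * B) ^ p) * 2 ^ p with hK
  have hK1 : 1 ≤ K := by
    rw [hK, add_assoc]
    exact le_add_of_nonneg_right (by positivity)
  have hKl : p.factorial / δ ^ p ≤ K := by
    have : (0 : ℝ) ≤ (E + (2 * B) ^ p) * 2 ^ p := by positivity
    linarith
  have hKu : (E + (2 * B) ^ p) * 2 ^ p ≤ K := by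
    have : (0 : ℝ) ≤ p.factorial / δ ^ p := by positivity
    linarith
  -- `192 = 32 * 6` combines the parameter loss with `D * b ≤ 6 * q`; `n ≥ 32 * B` absorbs the
  -- rounding up in `x`.
  refine ⟨K, 1 / (192 * B), hK1, by positivity, 32 * B, fun n hn s hs1 hsn A q hA => ?_⟩
  have hn' : 32 * (B : ℝ) ≤ n := by exact_mod_cast hn
  have hn0 : (0 : ℝ) < n := by linarith
  set y : ℝ := s ^ (1 / (p : ℝ)) with hy
  have hyp : y ^ p = s := by
    rw [hy, one_div]
    exact Real.rpow_inv_natCast_pow (by linarith) (by omega)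
  have hy1 : 1 ≤ y := Real.one_le_rpow hs1 (by positivity)
  have hyn : y ≤ C' * n := by
    refine le_of_pow_le_pow_left₀ (n := p) (by omega) (by positivity) ?_
    rw [mul_pow, hC'p, hyp]
    exact hsn
  set x : ℕ := ⌈δ * y⌉₊ with hx
  have hx0 : 0 < x := Nat.ceil_pos.2 (by positivity)
  have hxl : δ * y ≤ x := Nat.le_ceil _
  have hxu : (x : ℝ) ≤ δ * y + 1 := (Nat.ceil_lt_add_one (by positivity)).le
  have hx2 : (x : ℝ) ≤ 2 * y := by nlinarith
  have hxn : 16 * (B * x) ≤ n := by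
    have h1 : 32 * B * (δ * y) ≤ n := by
      have h2 : 32 * B * (δ * y) = y / (C' + 1) := by
        rw [hδ]
        field_simp
      rw [h2, div_le_iff₀ (by positivity)]
      nlinarith
    have h3 : 16 * ((B : ℝ) * x) ≤ n := by nlinarith
    exact_mod_cast h3
  obtain ⟨d, b, t, D, ht, hb, hD, hDt, hsize, hd, hgap, hlow, hupp, hfin⟩ :=
    exists_hard_parameters hp (by omega) hE.ge hBlam hx0 hxn
  have hlow' : s / K ≤ (d.choose p : ℕ) := by
    rw [div_le_iff₀ (by linarith)]
    have h1 : (x : ℝ) ^ p ≤ p.factorial * (d.choose p : ℕ) := by exact_mod_cast hlow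
    have h2 : δ ^ p * s ≤ (x : ℝ) ^ p := by
      rw [← hyp, ← mul_pow]
      exact pow_le_pow_left₀ (by positivity) hxl p
    calc s = δ ^ p * s / δ ^ p := by field_simp
      _ ≤ p.factorial * (d.choose p : ℕ) / δ ^ p :=
        div_le_div_of_nonneg_right (h2.trans h1) (by positivity)
      _ = (d.choose p : ℕ) * (p.factorial / δ ^ p) := by ring
      _ ≤ (d.choose p : ℕ) * K := by gcongr
  have hupp' : ((d.choose p + 2 * (b * t) * D.choose p + (2 * t).choose p : ℕ) : ℝ) ≤ K * s := by
    have h1 : ((d.choose p + 2 * (b * t) * D.choose p + (2 * t).choose p : ℕ) : ℝ) ≤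
        (E + (2 * B) ^ p) * (x : ℝ) ^ p := by exact_mod_cast hupp
    have h2 : (x : ℝ) ^ p ≤ 2 ^ p * s := by
      rw [← hyp, ← mul_pow]
      exact pow_le_pow_left₀ (by positivity) hx2 p
    calc _ ≤ (E + (2 * B) ^ p) * (x : ℝ) ^ p := h1
      _ ≤ (E + (2 * B) ^ p) * (2 ^ p * s) := by gcongr
      _ = ((E + (2 * B) ^ p) * 2 ^ p) * s := by ring
      _ ≤ K * s := by gcongr
  have hq : D * b ≤ 6 * q := by
    refine A.mul_le_of_approximates hp ht hb hD hDt hsize hlam hd hgap fun I h1 h2 => ?_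
    refine hA I (hlow'.trans ?_) (le_trans ?_ hupp')
    · exact_mod_cast h1
    · exact_mod_cast h2
  have hq' : ((D * b : ℕ) : ℝ) ≤ 6 * q := by exact_mod_cast hq
  rw [Real.rpow_sub hn0, Real.rpow_one, one_div_mul_eq_div, div_le_iff₀ (by positivity)]
  calc _ ≤ 32 * B * ((D * b : ℕ) : ℝ) := hfin
    _ ≤ 32 * B * (6 * q) := by gcongr
    _ = q * (192 * B) := by ring
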